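/- Let $\gamma,\kappa,m,Z$ be natural numbers with $Z\ge 1$, $\gamma,\kappa\ge 2$ and $(\gamma,\kappa)\neq(2,2)$ (equivalently $\gamma\kappa-\gamma-\kappa\ge 1$), and let $L_c$ be any coupling length. A partition matrix $\mathbf P\in\{0,\dots,m\}^{\gamma\times\kappa}$ splits the all-one $\gamma\times\kappa$ base matrix into components $\mathbf H_0,\dots,\mathbf H_m$, where $\mathbf H_\ell(i,j)=1$ if $\mathbf P(i,j)=\ell$ and $\mathbf H_\ell(i,j)=0$ otherwise. The coupled protograph has row blocks $0,\dots,m+L_c-1$ and column blocks $0,\dots,L_c-1$; its block in position $(r,t)$ is $\mathbf H_{r-t}$ if $0\le r-t\le m$ and $0$ otherwise. Given a lifting matrix $\mathbf L\in\mathbb Z_Z^{\gamma\times\kappa}$, the parity-check matrix of the QC-SC-LDPC code of $(\mathbf P,\mathbf L)$ is obtained by replacing each $1$ that comes from the base entry $(i,j)$ by $\sigma^{\mathbf L(i,j)}$, where $\sigma$ is the $Z\times Z$ identity matrix cyclically shifted left by one step, and each $0$ by the $Z\times Z$ zero matrix. Its Tanner graph is the bipartite graph with the rows and columns of this matrix as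 vertices and its nonzero entries as edges. A 4-cycle candidate $c_4=(j_1,i_1,j_2,i_2)\in\mathcal C_4$ consists of two distinct columns $j_1\ne j_2$ and two distinct rows $i_1\neq i_2$ of the base matrix. It is active for $(\mathbf P,\mathbf L)$ if the Tanner graph contains a 4-cycle lying over $j_1,i_1,j_2,i_2$. (For $L_c\ge m+1$ this means that $\mathbf P(i_1,j_1)+\mathbf P(i_2,j_2)=\mathbf P(i_1,j_2)+\mathbf P(i_2,j_1)$ and $\mathbf L(i_1,j_1)+\mathbf L(i_2,j_2)\equiv\mathbf L(i_1,j_2)+\mathbf L(i_2,j_1)\pmod Z$.) Let $\#\big(\bigcap_{c_4\in\mathcal C_4}\overline{c_4}\big)$ be the number of pairs $(\mathbf P,\mathbf L)$ for which no 4-cycle candidate is active. Put $\Delta=(2\gamma-3)(2\kappa-3)$, $\mathrm{I}=\dfrac{(\Delta-1)^{\Delta-1}}{\Delta^{\Delta}}$ and $\mathrm{II}=\dfrac{27}{256(\gamma\kappa-\gamma-\kappa)}$. If $$\frac{2m^2+4m+3}{3(m+1)^3Z}\le\max\{\mathrm{I},\mathrm{II}\}$$ (the left side is the probability that the two conditions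 above hold for a given candidate when all entries of $\mathbf P$ and $\mathbf L$ are independent and uniform), then $$\#\Big(\bigcap_{c_4\in\mathcal C_4}\overline{c_4}\Big)\ \ge\ [Z(m+1)]^{\gamma\kappa}\times\begin{cases}\left(1-\dfrac{2}{\Delta}\right)^{\binom{\gamma}{2}\binom{\kappa}{2}}, & \text{if } \mathrm{I}>\mathrm{II},\\[2mm] \left(1-\dfrac{\gamma\kappa-\gamma-\kappa+1}{4(\gamma\kappa-\gamma-\kappa)}\right)^{\gamma\kappa}, & \text{otherwise.}\end{cases}$$ -/

import Mathlib

namespace QCSC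

/-- A partition matrix: entry `(i, j)` says which of the component matrices `H_0, …, H_m`
receives the edge `(i, j)` of the all-one `γ × κ` base matrix. -/
abbrev PartitionMatrix (γ κ m : ℕ) := Matrix (Fin γ) (Fin κ) (Fin (m + 1))

/-- A lifting matrix: a circulant power in `{0, …, Z - 1}` for each edge of the base matrix. -/
abbrev LiftingMatrix (γ κ Z : ℕ) := Matrix (Fin γ) (Fin κ) (ZMod Z)

/-- The component matrix `H_ℓ` of the edge spreading recorded by `P`. -/
def componentMatrix {γ κ m : ℕ} (P : PartitionMatrix γ κ m) (l : Fin (m + 1)) :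
    Matrix (Fin γ) (Fin κ) (ZMod 2) :=
  Matrix.of fun i j => if P i j = l then 1 else 0

/-- The coupled protograph matrix with coupling length `Lc`. Column block `t` is a replica (the
stack of `H_0, …, H_m`) starting at row block `t`, so block `(r, t)` is `H_ℓ` if `r = t + ℓ`
with `0 ≤ ℓ ≤ m`, and zero otherwise. -/
def coupledProtograph {γ κ m : ℕ} (Lc : ℕ) (P : PartitionMatrix γ κ m) :
    Matrix (Fin (m + Lc) × Fin γ) (Fin Lc × Fin κ) (ZMod 2) :=
  Matrix.of fun a b => ∑ l : Fin (m + 1),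
    if (a.1 : ℕ) = (b.1 : ℕ) + (l : ℕ) then componentMatrix P l a.2 b.2 else 0

/-- The `Z × Z` circulant permutation matrix obtained from the identity by a one-step left
cyclic shift. -/
def circulantShift (Z : ℕ) : Matrix (ZMod Z) (ZMod Z) (ZMod 2) :=
  Matrix.of fun x y => if x = y + 1 then 1 else 0

/-- Check nodes: row block, row of the base matrix, row inside the circulant. -/
abbrev CheckNode (γ m Z Lc : ℕ) := (Fin (m + Lc) × Fin γ) × ZMod Z

/-- Variable nodes: column block, column of the base matrix, column inside the circulant. -/
abbrev VarNode (κ Z Lc : ℕ) := (Fin Lc × Fin κ) × ZMod Z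

/-- The parity-check matrix of the QC-SC-LDPC code given by `(P, L)` and the coupling length `Lc`:
every `1` of the coupled protograph coming from the base edge `(i, j)` is replaced by
`σ ^ L(i, j)`, and every `0` by the zero block. -/
def parityCheck {γ κ m Z : ℕ} [NeZero Z] (Lc : ℕ) (P : PartitionMatrix γ κ m)
    (L : LiftingMatrix γ κ Z) : Matrix (CheckNode γ m Z Lc) (VarNode κ Z Lc) (ZMod 2) :=
  Matrix.of fun a b =>
    coupledProtograph Lc P a.1 b.1 * (circulantShift Z ^ (L a.1.2 b.1.2).val) a.2 b.2

/-- The Tanner graph of a parity-check matrix: rows are check nodes, columns are variable nodes. -/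
def tannerGraph {R C : Type*} (H : Matrix R C (ZMod 2)) : SimpleGraph (R ⊕ C) :=
  SimpleGraph.fromRel fun u v => ∃ r c, u = Sum.inl r ∧ v = Sum.inr c ∧ H r c = 1

/-- The node of the base graph (rows and columns of the base matrix) below a node of the
Tanner graph. -/
def toBase {γ κ m Z Lc : ℕ} : CheckNode γ m Z Lc ⊕ VarNode κ Z Lc → Fin γ ⊕ Fin κ :=
  Sum.map (fun a => a.1.2) (fun b => b.1.2)

/-- A 4-cycle candidate `(j₁, i₁, j₂, i₂)` in the `γ × κ` base matrix. -/
structure FourCycle (γ κ : ℕ) where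
  j₁ : Fin κ
  i₁ : Fin γ
  j₂ : Fin κ
  i₂ : Fin γ
  hj : j₁ ≠ j₂
  hi : i₁ ≠ i₂

/-- The candidate `c` is active after edge spreading by `P` and `Z`-lifting by `L`: the Tanner
graph has a cycle that runs over the base nodes `j₁, i₁, j₂, i₂` and closes up. -/
def FourCycle.Active {γ κ m Z : ℕ} [NeZero Z] (Lc : ℕ) (P : PartitionMatrix γ κ m)
    (L : LiftingMatrix γ κ Z) (c : FourCycle γ κ) : Prop :=
  ∃ (v : CheckNode γ m Z Lc ⊕ VarNode κ Z Lc) (w : (tannerGraph (parityCheck Lc P L)).Walk v v),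
    w.IsCycle ∧ w.support.map toBase =
      [Sum.inr c.j₁, Sum.inl c.i₁, Sum.inr c.j₂, Sum.inl c.i₂, Sum.inr c.j₁]

/-- The pairs `(P, L)` for which no 4-cycle candidate is active. -/
def feasiblePairs (γ κ m Z Lc : ℕ) [NeZero Z] : Set (PartitionMatrix γ κ m × LiftingMatrix γ κ Z) :=
  {PL | ∀ c : FourCycle γ κ, ¬ c.Active Lc PL.1 PL.2}

/-- `Δ = (2γ - 3)(2κ - 3)`; it is only used for `γ, κ ≥ 2`, where nothing is truncated. -/
def Delta (γ κ : ℕ) : ℕ := (2 * γ - 3) * (2 * κ - 3)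

/-- The threshold `I = (Δ - 1)^(Δ - 1) / Δ^Δ`. -/
noncomputable def thresholdI (γ κ : ℕ) : ℝ :=
  ((Delta γ κ : ℝ) - 1) ^ (Delta γ κ - 1) / (Delta γ κ : ℝ) ^ Delta γ κ

/-- The threshold `II = 27 / (256 (γκ - γ - κ))`. -/
noncomputable def thresholdII (γ κ : ℕ) : ℝ :=
  27 / (256 * ((γ : ℝ) * κ - γ - κ))

end QCSC

/-! A pair `(P, L)` is an array `f` of symbols of `Fin (m + 1) × ZMod Z` indexed by the cells of the
base matrix. Going around a 4-cycle of the Tanner graph, the row-block shifts and the cyclic shifts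
cancel, so over an active candidate the alternating sum of the entries of `f` vanishes in
`ℕ × ZMod Z`: this rectangle of `f` closes. It remains to count the arrays in which no rectangle
closes.

For a uniformly random `f`, a rectangle closes with probability `E / (Z (m + 1)) ^ 4`, where `E` is
the additive energy of `{0, …, m} × ZMod Z`, even conditionally on the entries outside its four
cells. The local lemma applies in two ways. A rectangle shares a cell with `Δ - 1` others, and the
symmetric form with `x = 1 / Δ` yields threshold `I`. Alternatively, the `γκ` cells are cliques of a
dependency graph, each of `N + 1 = (γ - 1)(κ - 1)` rectangles, and every rectangle lies in four of
them. Once one of its cells is known to meet none of the avoided rectangles, only three cliques of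
at most `N` other rectangles have to be released, and `x = 1 / (4 N)` yields threshold `II`. As the
cells cover all rectangles, avoiding everything costs one factor `1 - (N + 1) x` per cell.
-/

section LocalLemma

open Finset MeasureTheory

variable {Ω V ι : Type*} {A : V → Set Ω} {S T : Finset V}

/-- The outcomes at which none of the events `A v` with `v ∈ S` occurs. -/
def avoiding (A : V → Set Ω) (S : Finset V) : Set Ω := ⋂ v ∈ S, (A v)ᶜ

lemma mem_avoiding {ω : Ω} : ω ∈ avoiding A S ↔ ∀ v ∈ S, ω ∉ A v := by
  simp [avoiding]

lemma avoiding_empty : avoiding A ∅ = Set.univ := by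
  simp [avoiding]

lemma avoiding_anti (h : T ⊆ S) : avoiding A S ⊆ avoiding A T :=
  Set.biInter_subset_biInter_left h

lemma avoiding_subset_union_biUnion [DecidableEq V] :
    avoiding A T ⊆ avoiding A S ∪ ⋃ w ∈ S \ T, A w ∩ avoiding A T := by
  intro ω hω
  simp only [Set.mem_union, Set.mem_iUnion, mem_sdiff, mem_avoiding, Set.mem_inter_iff] at hω ⊢
  grind

variable [MeasurableSpace Ω] {μ : Measure Ω} [IsFiniteMeasure μ] {x p : ℝ} {n k : ℕ}

lemma one_sub_mul_measureReal_avoiding_le [DecidableEq V]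
    (h : ∀ w ∈ S \ T, μ.real (A w ∩ avoiding A T) ≤ x * μ.real (avoiding A T)) :
    (1 - #(S \ T) * x) * μ.real (avoiding A T) ≤ μ.real (avoiding A S) := by
  have hsub : μ.real (avoiding A T) ≤
      μ.real (avoiding A S) + ∑ w ∈ S \ T, μ.real (A w ∩ avoiding A T) :=
    (measureReal_mono avoiding_subset_union_biUnion).trans <| (measureReal_union_le _ _).trans <|
      add_le_add_right (measureReal_biUnion_finset_le _ _) _
  have hsum : ∑ w ∈ S \ T, μ.real (A w ∩ avoiding A T) ≤ #(S \ T) * (x * μ.real (avoiding A T)) :=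
    (sum_le_card_nsmul _ _ _ h).trans_eq (nsmul_eq_mul _ _)
  linarith

variable [DecidableEq ι] {cl : V → Finset ι} {E : Finset V}

/- Requiring the events that carry one more label of `J` to be avoided costs at most a factor
`1 - n * x`, by the union bound over the at most `n` events carrying that label. -/
lemma pow_mul_measureReal_avoiding_filter_disjoint_le {J : Finset ι} (hx : 0 ≤ x)
    (hnx : n * x ≤ 1) (hJ : ∀ j ∈ J, #{w ∈ S | j ∈ cl w} ≤ n)
    (h : ∀ T ⊂ S, ∀ w ∈ S, ∀ j ∈ cl w, (∀ u ∈ T, j ∉ cl u) →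
      μ.real (A w ∩ avoiding A T) ≤ x * μ.real (avoiding A T)) :
    (1 - n * x) ^ #J * μ.real (avoiding A {w ∈ S | Disjoint J (cl w)}) ≤
      μ.real (avoiding A S) := by
  classical
  induction J using Finset.induction_on with
  | empty => simp
  | insert j J hj ih =>
    set T := {w ∈ S | Disjoint J (cl w)}
    set T' := {w ∈ S | Disjoint (insert j J) (cl w)}
    have hsub : T \ T' ⊆ {w ∈ S | j ∈ cl w} := by
      intro w
      simp only [T, T', mem_sdiff, mem_filter, disjoint_insert_left]
      tauto
    have hcard : (#(T \ T') : ℝ) ≤ n :=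
      mod_cast (card_le_card hsub).trans (hJ j (mem_insert_self j J))
    have hstep : (1 - n * x) * μ.real (avoiding A T') ≤ μ.real (avoiding A T) := by
      refine le_trans (by gcongr) (one_sub_mul_measureReal_avoiding_le (x := x) fun w hw => ?_)
      obtain ⟨hwS, hjw⟩ := mem_filter.1 (hsub hw)
      have hT' : T' ⊂ S := filter_ssubset.2
        ⟨w, hwS, fun hd => (disjoint_insert_left.1 hd).1 hjw⟩
      exact h T' hT' w hwS j hjw fun u hu => (disjoint_insert_left.1 (mem_filter.1 hu).2).1
    have : 0 ≤ 1 - n * x := by linarith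
    calc (1 - n * x) ^ #(insert j J) * μ.real (avoiding A T')
        = (1 - n * x) ^ #J * ((1 - n * x) * μ.real (avoiding A T')) := by
          rw [card_insert_of_notMem hj, pow_succ, mul_assoc]
      _ ≤ (1 - n * x) ^ #J * μ.real (avoiding A T) := by gcongr
      _ ≤ μ.real (avoiding A S) := ih fun i hi => hJ i (mem_insert_of_mem hi)

/-- The dependency condition of the local lemma for events `A v`, `v ∈ E`, that carry labels
`cl v`: given a label `i` of `A v`, at most `k` further labels `J`, each on at most `n` events
without the label `i`, separate `A v` from the other events, in that avoiding any events with
labels outside `J ∪ {i}` leaves `A v` conditional probability at most `p`. -/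
def LabelDependency (μ : Measure Ω) (A : V → Set Ω) (cl : V → Finset ι) (E : Finset V) (n k : ℕ)
    (p : ℝ) : Prop :=
  ∀ v ∈ E, ∀ i ∈ cl v, ∃ J : Finset ι, #J ≤ k ∧ (∀ j ∈ J, #{w ∈ E | i ∉ cl w ∧ j ∈ cl w} ≤ n) ∧
    ∀ S ⊆ E, (∀ w ∈ S, i ∉ cl w ∧ Disjoint J (cl w)) →
      μ.real (A v ∩ avoiding A S) ≤ p * μ.real (avoiding A S)

lemma LabelDependency.measureReal_inter_avoiding_le (hE : LabelDependency μ A cl E n k p)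
    (hx : 0 ≤ x) (hnx : n * x ≤ 1) (hp : p ≤ x * (1 - n * x) ^ k) (hS : S ⊆ E) {v : V} (hv : v ∈ E)
    {i : ι} (hi : i ∈ cl v) (hiS : ∀ w ∈ S, i ∉ cl w) :
    μ.real (A v ∩ avoiding A S) ≤ x * μ.real (avoiding A S) := by
  induction S using Finset.strongInduction generalizing v i with
  | H S ih =>
  obtain ⟨J, hJk, hJn, hJ⟩ := hE v hv i hi
  set S' := {w ∈ S | Disjoint J (cl w)}
  have hS' : S' ⊆ S := filter_subset _ _
  have hcarry : ∀ j ∈ J, #{w ∈ S | j ∈ cl w} ≤ n := fun j hj =>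
    (card_le_card fun w hw => by
      obtain ⟨hwS, hjw⟩ := mem_filter.1 hw
      exact mem_filter.2 ⟨hS hwS, hiS w hwS, hjw⟩).trans (hJn j hj)
  have hpeel : (1 - n * x) ^ #J * μ.real (avoiding A S') ≤ μ.real (avoiding A S) :=
    pow_mul_measureReal_avoiding_filter_disjoint_le hx hnx hcarry fun T hT w hw j hj hjT =>
      ih T hT (hT.1.trans hS) (hS hw) hj hjT
  have hfactor : 0 ≤ 1 - n * x := by linarith
  have hfactor' : 1 - n * x ≤ 1 := by linarith [mul_nonneg n.cast_nonneg hx]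
  calc μ.real (A v ∩ avoiding A S)
      ≤ μ.real (A v ∩ avoiding A S') :=
        measureReal_mono (Set.inter_subset_inter_right _ (avoiding_anti hS'))
    _ ≤ p * μ.real (avoiding A S') :=
        hJ S' (hS'.trans hS) fun w hw => ⟨hiS w (hS' hw), (mem_filter.1 hw).2⟩
    _ ≤ x * (1 - n * x) ^ #J * μ.real (avoiding A S') := by
        gcongr
        exact hp.trans (by gcongr x * ?_; exact pow_le_pow_of_le_one hfactor hfactor' hJk)
    _ ≤ x * μ.real (avoiding A S) := by
        rw [mul_assoc]
        gcongr

theorem LabelDependency.pow_mul_measureReal_univ_le (hE : LabelDependency μ A cl E n k p)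
    (hx : 0 ≤ x) (hnx : n * x ≤ 1) (hp : p ≤ x * (1 - n * x) ^ k) {N : ℕ} (hNx : N * x ≤ 1)
    {J : Finset ι} (hJ : ∀ v ∈ E, ¬Disjoint J (cl v)) (hN : ∀ j ∈ J, #{w ∈ E | j ∈ cl w} ≤ N) :
    (1 - N * x) ^ #J * μ.real Set.univ ≤ μ.real (avoiding A E) := by
  have hempty : {w ∈ E | Disjoint J (cl w)} = ∅ := filter_eq_empty_iff.2 fun {w} => hJ w
  have hpeel := pow_mul_measureReal_avoiding_filter_disjoint_le (μ := μ) (A := A) hx hNx hN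
    fun T hT w hw j hj hjT => hE.measureReal_inter_avoiding_le hx hnx hp hT.1 hw hj hjT
  rwa [hempty, avoiding_empty] at hpeel

theorem symmetric_local_lemma {Γ : V → Finset V} {d : ℕ} (hx : 0 ≤ x)
    (hx1 : x ≤ 1) (hp : p ≤ x * (1 - x) ^ d) (hd : ∀ v ∈ E, #(Γ v) ≤ d)
    (hA : ∀ v ∈ E, ∀ S ⊆ E, v ∉ S → Disjoint (Γ v) S →
      μ.real (A v ∩ avoiding A S) ≤ p * μ.real (avoiding A S)) :
    (1 - x) ^ #E * μ.real Set.univ ≤ μ.real (avoiding A E) := by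
  classical
  have hself (P : V → Prop) [DecidablePred P] (j : V) :
      #{w ∈ E | P w ∧ j ∈ ({w} : Finset V)} ≤ 1 := by
    refine card_le_one.2 fun a ha b hb => ?_
    simp only [mem_filter, mem_singleton] at ha hb
    exact ha.2.2.symm.trans hb.2.2
  have hdep : LabelDependency μ A (fun v => {v}) E 1 d p := by
    refine fun v hv i hi => ⟨Γ v, hd v hv, fun j _ => hself _ j, fun S hS hvS => ?_⟩
    obtain rfl := mem_singleton.1 hi
    refine hA i hv S hS (fun hiS => (hvS i hiS).1 hi) (disjoint_right.2 fun w hw => ?_)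
    exact disjoint_singleton_right.1 (hvS w hw).2
  simpa using hdep.pow_mul_measureReal_univ_le hx (by simpa using hx1) (by simpa using hp)
    (N := 1) (by simpa using hx1) (J := E) (by simp)
    fun j _ => by simpa using hself (fun _ => True) j

theorem clique_local_lemma [Fintype ι] (hx : 0 ≤ x) (hnx : (n + 1) * x ≤ 1)
    (hp : p ≤ x * (1 - n * x) ^ k) (hcl : ∀ v ∈ E, #(cl v) = k + 1)
    (hn : ∀ j, #{w ∈ E | j ∈ cl w} ≤ n + 1)
    (hA : ∀ v ∈ E, ∀ S ⊆ E, (∀ w ∈ S, Disjoint (cl v) (cl w)) →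
      μ.real (A v ∩ avoiding A S) ≤ p * μ.real (avoiding A S)) :
    (1 - (n + 1) * x) ^ Fintype.card ι * μ.real Set.univ ≤ μ.real (avoiding A E) := by
  classical
  have hdep : LabelDependency μ A cl E n k p := by
    intro v hv i hi
    refine ⟨(cl v).erase i, ?_, fun j hj => ?_, fun S hS hiS => hA v hv S hS fun w hw => ?_⟩
    · rw [card_erase_of_mem hi, hcl v hv, Nat.add_sub_cancel]
    · have hvj : v ∈ ({w ∈ E | j ∈ cl w} : Finset V) := mem_filter.2 ⟨hv, mem_of_mem_erase hj⟩
      have hsub : {w ∈ E | i ∉ cl w ∧ j ∈ cl w} ⊆ ({w ∈ E | j ∈ cl w} : Finset V).erase v := by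
        intro w
        simp only [mem_filter, mem_erase]
        grind
      exact (card_le_card hsub).trans <| by
        rw [card_erase_of_mem hvj]
        exact Nat.sub_le_of_le_add (hn j)
    · rw [← insert_erase hi, disjoint_insert_left]
      exact hiS w hw
  have hcover : ∀ v ∈ E, ¬Disjoint univ (cl v) := fun v hv hd => by
    simpa [hcl v hv] using congrArg card (disjoint_self.1 (hd.mono_left (subset_univ (cl v))))
  have hbound := hdep.pow_mul_measureReal_univ_le hx (by linarith) hp (N := n + 1)
    (mod_cast hnx) hcover fun j _ => hn j
  rwa [card_univ, Nat.cast_add_one] at hbound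

end LocalLemma

section UniformArrays

open Function MeasureTheory

lemma count_real_eq_ncard {Ω : Type*} [MeasurableSpace Ω] [DiscreteMeasurableSpace Ω] (s : Set Ω) :
    Measure.count.real s = s.ncard := by
  rw [measureReal_def, Measure.count_apply .of_discrete, Set.ncard]
  induction s.encard using ENat.recTopCoe <;> simp

variable {ι : Type*}

lemma ncard_inter_mul_card_of_dependsOn {α : ι → Type*} {A B : Set (∀ i, α i)} {s : Set ι}
    (hA : DependsOn (· ∈ A) s) (hB : DependsOn (· ∈ B) sᶜ) :
    (A ∩ B).ncard * Nat.card (∀ i, α i) = A.ncard * B.ncard := by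
  classical
  -- Exchanging the coordinates in `s` of two points turns `A × B` into `(A ∩ B) × univ`.
  let swap : (∀ i, α i) × (∀ i, α i) → (∀ i, α i) × (∀ i, α i) :=
    fun q => (s.piecewise q.1 q.2, s.piecewise q.2 q.1)
  have hswap : Involutive swap := fun q => by
    ext i <;> by_cases hi : i ∈ s <;> simp [swap, hi]
  have hpre : swap ⁻¹' ((A ∩ B) ×ˢ Set.univ) = A ×ˢ B := by
    ext ⟨f, g⟩
    have hf : (s.piecewise f g ∈ A) = (f ∈ A) := hA fun i hi => Set.piecewise_eq_of_mem s f g hi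
    have hg : (s.piecewise f g ∈ B) = (g ∈ B) := hB fun i hi => Set.piecewise_eq_of_notMem s f g hi
    simp [swap, hf, hg]
  rw [← Set.ncard_univ, ← Set.ncard_prod, ← Set.ncard_prod, ← hpre,
    Set.ncard_preimage_of_injective_subset_range hswap.injective
      (hswap.surjective.range_eq ▸ Set.subset_univ _)]

lemma ncard_comp_mem_mul_card {β α : Type*} {e : β → ι} (he : Injective e) (Q : Set (β → α)) :
    {f : ι → α | f ∘ e ∈ Q}.ncard * Nat.card (β → α) = Q.ncard * Nat.card (ι → α) := by
  -- Exchange the values of `f` along `e` with a function on `β`.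
  let swap : (ι → α) × (β → α) → (ι → α) × (β → α) := fun q => (extend e q.2 q.1, q.1 ∘ e)
  have hswap : Involutive swap := fun ⟨f, g⟩ => by
    refine Prod.ext (funext fun i => ?_) (extend_comp he g f)
    by_cases hi : ∃ b, e b = i
    · obtain ⟨b, rfl⟩ := hi
      simp [swap, he.extend_apply]
    · simp [swap, extend_apply' _ _ _ hi]
  have hpre : swap ⁻¹' (Set.univ ×ˢ Q) = {f : ι → α | f ∘ e ∈ Q} ×ˢ Set.univ := by
    ext
    simp [swap]
  rw [← Set.ncard_univ, ← Set.ncard_univ, mul_comm Q.ncard, ← Set.ncard_prod, ← Set.ncard_prod,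
    ← hpre, Set.ncard_preimage_of_injective_subset_range hswap.injective
      (hswap.surjective.range_eq ▸ Set.subset_univ _)]

end UniformArrays

section Energy

open Finset
open scoped Pointwise

lemma addEnergy_product {G H : Type*} [Add G] [Add H] [DecidableEq G] [DecidableEq H]
    (s s' : Finset G) (t t' : Finset H) :
    (s ×ˢ t).addEnergy (s' ×ˢ t') = s.addEnergy s' * t.addEnergy t' := by
  rw [addEnergy, addEnergy, addEnergy, ← card_product]
  refine card_equiv (((Equiv.prodProdProdComm G H G H).prodCongr
    (Equiv.prodProdProdComm G H G H)).trans (Equiv.prodProdProdComm _ _ _ _)) fun q => ?_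
  simp only [Equiv.trans_apply, Equiv.prodCongr_apply, Equiv.prodProdProdComm_apply, Prod.map_fst,
    Prod.map_snd, mem_filter, mem_product, Prod.ext_iff, Prod.fst_add, Prod.snd_add]
  tauto

lemma card_filter_range_product_add_eq (M k : ℕ) :
    #{q ∈ range M ×ˢ range M | q.1 + q.2 = k} = min M (k + 1) - (k + 1 - M) := by
  rw [← Nat.card_Ico]
  refine card_bij' (fun q _ => q.1) (fun a _ => (a, k - a)) ?_ ?_ ?_ ?_ <;> grind

lemma addEnergy_range (M : ℕ) :
    (range M).addEnergy (range M) = ∑ k ∈ range M, ((k + 1) ^ 2 + k ^ 2) := by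
  have hsums : range M + range M ⊆ range (M + M) := by
    rw [add_subset_iff]
    simp only [mem_range]
    grind
  have hreflect : ∑ j ∈ range M, (M - 1 - j) ^ 2 = ∑ j ∈ range M, j ^ 2 :=
    sum_range_reflect (fun j => j ^ 2) M
  rw [addEnergy_eq_sum_sq', sum_subset hsums fun k _ hk => by
    rw [sq_eq_zero_iff, card_eq_zero, filter_eq_empty_iff]
    rintro q hq rfl
    exact hk (add_mem_add (mem_product.1 hq).1 (mem_product.1 hq).2)]
  simp only [card_filter_range_product_add_eq]
  rw [sum_range_add, sum_add_distrib, ← hreflect]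
  congr 1 <;> refine sum_congr rfl fun k hk => ?_ <;> rw [mem_range] at hk <;> congr 1 <;> omega

lemma three_mul_addEnergy_range (M : ℕ) :
    3 * (range M).addEnergy (range M) = M * (2 * M ^ 2 + 1) := by
  rw [addEnergy_range]
  induction M with
  | zero => simp
  | succ M ih =>
    rw [sum_range_succ, mul_add, ih]
    ring

end Energy

section PowersetCard

open Finset

variable {α : Type*} [Fintype α] [DecidableEq α]

lemma card_filter_mem_powersetCard_univ (k : ℕ) (a : α) :
    #{s ∈ powersetCard (k + 1) (univ : Finset α) | a ∈ s} = (Fintype.card α - 1).choose k := by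
  simpa using card_filter_powersetCard_subset {a} univ (k + 1) (subset_univ _) (by simp)

lemma card_filter_not_disjoint_powersetCard_two {s : Finset α} (hs : #s = 2) :
    #{t ∈ powersetCard 2 (univ : Finset α) | ¬Disjoint s t} = 2 * Fintype.card α - 3 := by
  have hdisj : {t ∈ powersetCard 2 (univ : Finset α) | Disjoint s t} = powersetCard 2 sᶜ := by
    ext t
    simp [mem_powersetCard, subset_compl_iff_disjoint_left, and_comm]
  have hsplit := card_filter_add_card_filter_not
    (s := powersetCard 2 (univ : Finset α)) fun t => Disjoint s t
  rw [hdisj, card_powersetCard, card_powersetCard, card_compl, hs, card_univ] at hsplit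
  obtain ⟨k, hk⟩ : ∃ k, Fintype.card α = k + 2 := Nat.exists_eq_add_of_le' (hs ▸ card_le_univ s)
  have hchoose : (k + 2).choose 2 = (k + 1) + (k + k.choose 2) := by
    simp [Nat.choose_succ_succ' (k + 1) 1, Nat.choose_succ_succ' k 1]
  rw [hk, hchoose, Nat.add_sub_cancel] at hsplit
  omega

end PowersetCard

section ClosingArrays

open Finset MeasureTheory

variable {R C α G : Type*}

/-- The rectangle with rows `i₁`, `i₂` and columns `j₁`, `j₂` closes in the array `f`: the
alternating sum of `f` around it vanishes. Without subtraction, so that entries may be natural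
numbers. -/
def RectangleCloses [Add G] (f : R × C → G) (i₁ i₂ : R) (j₁ j₂ : C) : Prop :=
  f (i₁, j₁) + f (i₂, j₂) = f (i₁, j₂) + f (i₂, j₁)

section AddCommMagma

variable [AddCommMagma G] {f : R × C → G} {i₁ i₂ : R} {j₁ j₂ : C}

lemma RectangleCloses.swap_rows (h : RectangleCloses f i₁ i₂ j₁ j₂) :
    RectangleCloses f i₂ i₁ j₁ j₂ :=
  (add_comm _ _).trans (h.symm.trans (add_comm _ _))

lemma RectangleCloses.swap_columns (h : RectangleCloses f i₁ i₂ j₁ j₂) :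
    RectangleCloses f i₁ i₂ j₂ j₁ :=
  Eq.symm h

end AddCommMagma

/-- The arrays over `α` none of whose rectangles closes under the labelling `φ` of `α`. -/
def rectangleFree [Add G] (φ : α → G) : Set (R × C → α) :=
  {f | ∀ i₁ i₂ j₁ j₂, i₁ ≠ i₂ → j₁ ≠ j₂ → ¬RectangleCloses (φ ∘ f) i₁ i₂ j₁ j₂}

/-- The arrays over `α` in which some rectangle with rows in `c.1` and columns in `c.2` closes under
the labelling `φ` of `α`. -/
def closingArrays [Add G] (φ : α → G) (c : Finset R × Finset C) : Set (R × C → α) :=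
  {f | ∃ i₁ ∈ c.1, ∃ i₂ ∈ c.1, ∃ j₁ ∈ c.2, ∃ j₂ ∈ c.2,
    i₁ ≠ i₂ ∧ j₁ ≠ j₂ ∧ RectangleCloses (φ ∘ f) i₁ i₂ j₁ j₂}

lemma mem_closingArrays_pair [DecidableEq R] [DecidableEq C] [AddCommMagma G] {φ : α → G}
    {f : R × C → α} {i₁ i₂ : R} {j₁ j₂ : C} (hi : i₁ ≠ i₂) (hj : j₁ ≠ j₂) :
    f ∈ closingArrays φ ({i₁, i₂}, {j₁, j₂}) ↔ RectangleCloses (φ ∘ f) i₁ i₂ j₁ j₂ := by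
  refine ⟨?_, fun h => ⟨i₁, by simp, i₂, by simp, j₁, by simp, j₂, by simp, hi, hj, h⟩⟩
  rintro ⟨a, ha, b, hb, c, hc, d, hd, hab, hcd, h⟩
  have hrows : RectangleCloses (φ ∘ f) i₁ i₂ c d := by
    simp only [mem_insert, mem_singleton] at ha hb
    grind [RectangleCloses.swap_rows]
  simp only [mem_insert, mem_singleton] at hc hd
  grind [RectangleCloses.swap_columns]

lemma dependsOn_closingArrays [Add G] (φ : α → G) (c : Finset R × Finset C) :
    DependsOn (· ∈ closingArrays φ c) (c.1 ×ˢ c.2 : Finset (R × C)) := by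
  intro f g hfg
  have hcell : ∀ i ∈ c.1, ∀ j ∈ c.2, f (i, j) = g (i, j) := fun i hi j hj =>
    hfg (i, j) (mem_coe.2 (mk_mem_product hi hj))
  simp only [closingArrays, RectangleCloses, Set.mem_ofPred_eq, Function.comp_apply]
  grind

lemma dependsOn_avoiding_closingArrays [Add G] (φ : α → G) {s : Finset (R × C)}
    {S : Finset (Finset R × Finset C)} (hS : ∀ c ∈ S, Disjoint s (c.1 ×ˢ c.2)) :
    DependsOn (· ∈ avoiding (closingArrays φ) S) (s : Set (R × C))ᶜ := by
  intro f g hfg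
  have hiff : ∀ c ∈ S, (f ∈ closingArrays φ c ↔ g ∈ closingArrays φ c) := fun c hc =>
    iff_of_eq <| dependsOn_closingArrays φ c fun q hq =>
      hfg q fun hqs => disjoint_left.1 (hS c hc) hqs hq
  simpa only [mem_avoiding, eq_iff_iff] using forall₂_congr fun c hc => not_congr (hiff c hc)

section Rectangles

variable (R C) [Fintype R] [Fintype C]

/-- The pairs of two rows and two columns. -/
def rectangles : Finset (Finset R × Finset C) :=
  powersetCard 2 univ ×ˢ powersetCard 2 univ

variable {R C}

lemma mem_rectangles {c : Finset R × Finset C} : c ∈ rectangles R C ↔ #c.1 = 2 ∧ #c.2 = 2 := by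
  simp [rectangles, mem_powersetCard]

lemma card_rectangles :
    #(rectangles R C) = (Fintype.card R).choose 2 * (Fintype.card C).choose 2 := by
  simp [rectangles]

lemma avoiding_closingArrays_rectangles [AddCommMagma G] (φ : α → G) :
    avoiding (closingArrays φ) (rectangles R C) = rectangleFree φ := by
  classical
  ext f
  rw [mem_avoiding]
  refine ⟨fun h i₁ i₂ j₁ j₂ hi hj hf => h ({i₁, i₂}, {j₁, j₂}) ?_ ?_, ?_⟩
  · exact mem_rectangles.2 ⟨card_pair hi, card_pair hj⟩
  · exact (mem_closingArrays_pair hi hj).2 hf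
  · rintro h c - ⟨i₁, -, i₂, -, j₁, -, j₂, -, hi, hj, hf⟩
    exact h i₁ i₂ j₁ j₂ hi hj hf

variable [DecidableEq R] [DecidableEq C]

lemma card_filter_mem_rectangles (q : R × C) :
    #{c ∈ rectangles R C | q ∈ c.1 ×ˢ c.2} = (Fintype.card R - 1) * (Fintype.card C - 1) := by
  rw [← Nat.choose_one_right (Fintype.card R - 1), ← Nat.choose_one_right (Fintype.card C - 1),
    ← card_filter_mem_powersetCard_univ 1 q.1, ← card_filter_mem_powersetCard_univ 1 q.2,
    ← card_product]
  congr 1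
  ext c
  simp only [rectangles, mem_filter, mem_product]
  tauto

lemma card_filter_not_disjoint_rectangles {c : Finset R × Finset C} (hc : c ∈ rectangles R C) :
    #{d ∈ rectangles R C | ¬Disjoint (c.1 ×ˢ c.2) (d.1 ×ˢ d.2)} =
      (2 * Fintype.card R - 3) * (2 * Fintype.card C - 3) := by
  obtain ⟨hR, hC⟩ := mem_rectangles.1 hc
  rw [← card_filter_not_disjoint_powersetCard_two hR,
    ← card_filter_not_disjoint_powersetCard_two hC, ← card_product]
  congr 1
  ext d
  simp only [rectangles, mem_filter, mem_product, disjoint_product]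
  tauto

end Rectangles

variable [AddCommMonoid G] [DecidableEq G] [Fintype α]

/-- The probability that a given rectangle closes under the labelling `φ` of `α` in a uniformly
random array over `α`. -/
noncomputable def closingProb (φ : α ↪ G) : ℝ :=
  (univ.map φ).addEnergy (univ.map φ) / (Fintype.card α : ℝ) ^ 4

lemma ncard_setOf_rectangleCloses (φ : α ↪ G) :
    {f : Fin 2 × Fin 2 → α | RectangleCloses (φ ∘ f) 0 1 0 1}.ncard =
      (univ.map φ).addEnergy (univ.map φ) := by
  let corners (f : Fin 2 × Fin 2 → α) : (G × G) × G × G :=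
    ((φ (f (0, 0)), φ (f (0, 1))), φ (f (1, 1)), φ (f (1, 0)))
  rw [addEnergy, ← Set.ncard_coe_finset]
  refine Set.BijOn.ncard_eq (f := corners) ⟨fun f hf => ?_, fun f _ g _ hfg => ?_, ?_⟩
  · simpa [corners, RectangleCloses] using hf
  · simp only [corners, Prod.mk.injEq, φ.apply_eq_iff_eq] at hfg
    ext ⟨i, j⟩
    fin_cases i <;> fin_cases j <;> simp [hfg]
  · rintro ⟨⟨_, _⟩, _, _⟩ hx
    simp only [coe_filter, mem_product, mem_map, mem_univ, true_and, Set.mem_ofPred_eq] at hx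
    obtain ⟨⟨⟨⟨a, rfl⟩, b, rfl⟩, ⟨c, rfl⟩, d, rfl⟩, hsum⟩ := hx
    exact ⟨fun q => !![a, b; d, c] q.1 q.2, by simpa [RectangleCloses] using hsum,
      by simp [corners]⟩

variable [Fintype R] [Fintype C] [Nonempty α]

lemma ncard_closingArrays (φ : α ↪ G) {c : Finset R × Finset C} (hc : c ∈ rectangles R C) :
    ((closingArrays φ c).ncard : ℝ) = closingProb φ * Nat.card (R × C → α) := by
  classical
  obtain ⟨s, t⟩ := c
  obtain ⟨hs, ht⟩ := mem_rectangles.1 hc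
  obtain ⟨i₁, i₂, hi, rfl⟩ := card_eq_two.1 hs
  obtain ⟨j₁, j₂, hj, rfl⟩ := card_eq_two.1 ht
  let Q : Set (Fin 2 × Fin 2 → α) := {g | RectangleCloses (φ ∘ g) 0 1 0 1}
  have hcorners : closingArrays φ ({i₁, i₂}, {j₁, j₂}) =
      {f | f ∘ Prod.map ![i₁, i₂] ![j₁, j₂] ∈ Q} :=
    Set.ext fun f => mem_closingArrays_pair hi hj
  have hcount := ncard_comp_mem_mul_card
    ((injective_pair_iff_ne.2 hi).prodMap (injective_pair_iff_ne.2 hj)) Q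
  have hcard : Nat.card (Fin 2 × Fin 2 → α) = Fintype.card α ^ 4 := by simp
  rw [← hcorners, ncard_setOf_rectangleCloses, hcard] at hcount
  rw [closingProb, div_mul_eq_mul_div, eq_div_iff (by positivity)]
  exact_mod_cast hcount

lemma ncard_closingArrays_inter_avoiding (φ : α ↪ G) {c : Finset R × Finset C}
    (hc : c ∈ rectangles R C) {S : Finset (Finset R × Finset C)}
    (hS : ∀ d ∈ S, Disjoint (c.1 ×ˢ c.2) (d.1 ×ˢ d.2)) :
    ((closingArrays φ c ∩ avoiding (closingArrays φ) S).ncard : ℝ) =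
      closingProb φ * (avoiding (closingArrays φ) S).ncard := by
  have hindep := ncard_inter_mul_card_of_dependsOn (dependsOn_closingArrays φ c)
    (dependsOn_avoiding_closingArrays φ hS)
  have hcard : (Nat.card (R × C → α) : ℝ) ≠ 0 := Nat.cast_ne_zero.2 Nat.card_pos.ne'
  refine mul_right_cancel₀ hcard ?_
  rw [← Nat.cast_mul, hindep, Nat.cast_mul, ncard_closingArrays φ hc]
  ring

theorem pow_choose_mul_card_le_ncard_rectangleFree (φ : α ↪ G) {x : ℝ} (hx : 0 ≤ x) (hx1 : x ≤ 1)
    (hp : closingProb φ ≤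
      x * (1 - x) ^ ((2 * Fintype.card R - 3) * (2 * Fintype.card C - 3) - 1)) :
    (1 - x) ^ ((Fintype.card R).choose 2 * (Fintype.card C).choose 2) * Nat.card (R × C → α) ≤
      (rectangleFree φ : Set (R × C → α)).ncard := by
  classical
  let _ : MeasurableSpace (R × C → α) := ⊤
  let meeting (c : Finset R × Finset C) : Finset (Finset R × Finset C) :=
    {d ∈ rectangles R C | ¬Disjoint (c.1 ×ˢ c.2) (d.1 ×ˢ d.2)}
  have hcard : ∀ c ∈ rectangles R C, #((meeting c).erase c) ≤
      (2 * Fintype.card R - 3) * (2 * Fintype.card C - 3) - 1 := by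
    intro c hc
    have hself : c ∈ meeting c := by
      obtain ⟨hR, hC⟩ := mem_rectangles.1 hc
      refine mem_filter.2 ⟨hc, ?_⟩
      simp [← card_eq_zero, hR, hC]
    rw [card_erase_of_mem hself, card_filter_not_disjoint_rectangles hc]
  have hlll := symmetric_local_lemma (μ := Measure.count) (A := closingArrays φ) hx hx1 hp hcard
    fun c hc S hS hcS hdisj => by
      rw [count_real_eq_ncard, count_real_eq_ncard]
      refine (ncard_closingArrays_inter_avoiding φ hc fun d hd => ?_).le
      by_contra hmeet
      refine disjoint_right.1 hdisj hd (mem_erase.2 ⟨?_, mem_filter.2 ⟨hS hd, hmeet⟩⟩)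
      exact ne_of_mem_of_not_mem hd hcS
  rwa [card_rectangles, avoiding_closingArrays_rectangles, count_real_eq_ncard, count_real_eq_ncard,
    Set.ncard_univ] at hlll

theorem pow_card_mul_card_le_ncard_rectangleFree (φ : α ↪ G) {x : ℝ} {n : ℕ}
    (hn : (Fintype.card R - 1) * (Fintype.card C - 1) ≤ n + 1) (hx : 0 ≤ x)
    (hnx : (n + 1) * x ≤ 1) (hp : closingProb φ ≤ x * (1 - n * x) ^ 3) :
    (1 - (n + 1) * x) ^ (Fintype.card R * Fintype.card C) * Nat.card (R × C → α) ≤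
      (rectangleFree φ : Set (R × C → α)).ncard := by
  classical
  let _ : MeasurableSpace (R × C → α) := ⊤
  have hlll := clique_local_lemma (μ := Measure.count) (A := closingArrays φ)
    (cl := fun c => c.1 ×ˢ c.2) (E := rectangles R C) hx hnx hp
    (fun c hc => by rw [card_product, (mem_rectangles.1 hc).1, (mem_rectangles.1 hc).2])
    (fun q => (card_filter_mem_rectangles q).trans_le hn)
    fun c hc S _ hS => by
      rw [count_real_eq_ncard, count_real_eq_ncard, ncard_closingArrays_inter_avoiding φ hc hS]
  rwa [Fintype.card_prod, avoiding_closingArrays_rectangles, count_real_eq_ncard,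
    count_real_eq_ncard, Set.ncard_univ] at hlll

end ClosingArrays

namespace QCSC

open Finset

variable {γ κ m Z Lc : ℕ}

lemma coupledProtograph_apply (P : PartitionMatrix γ κ m) (a : Fin (m + Lc) × Fin γ)
    (b : Fin Lc × Fin κ) :
    coupledProtograph Lc P a b = if (a.1 : ℕ) = b.1 + P a.2 b.2 then 1 else 0 := by
  rw [coupledProtograph, Matrix.of_apply, sum_eq_single (P a.2 b.2)]
  · simp [componentMatrix]
  · intro l _ hl
    simp [componentMatrix, hl.symm]
  · simp

lemma circulantShift_pow_apply [NeZero Z] (k : ℕ) (x y : ZMod Z) :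
    (circulantShift Z ^ k) x y = if x = y + k then 1 else 0 := by
  induction k generalizing x y with
  | zero => simp [Matrix.one_apply]
  | succ k ih =>
    rw [pow_succ, Matrix.mul_apply]
    simp only [ih]
    simp [circulantShift, add_comm, add_left_comm]

/-- The total shift, by row blocks and cyclically within a block, that a base entry with partition
value `q.1` and lifting value `q.2` contributes to a path in the Tanner graph. -/
def edgeShift (m Z : ℕ) : Fin (m + 1) × ZMod Z ↪ ℕ × ZMod Z :=
  Fin.valEmbedding.prodMap (.refl _)

lemma eq_add_edgeShift_of_parityCheck_eq_one [NeZero Z] {P : PartitionMatrix γ κ m}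
    {L : LiftingMatrix γ κ Z} {a : CheckNode γ m Z Lc} {b : VarNode κ Z Lc}
    (h : parityCheck Lc P L a b = 1) :
    ((a.1.1 : ℕ), a.2) =
      ((b.1.1 : ℕ), b.2) + edgeShift m Z (P a.1.2 b.1.2, L a.1.2 b.1.2) := by
  simpa [parityCheck, coupledProtograph_apply, circulantShift_pow_apply, edgeShift, ite_eq_iff,
    and_comm] using h

lemma tannerGraph_adj_inl_inr {R C : Type*} {H : Matrix R C (ZMod 2)} {r : R} {c : C} :
    (tannerGraph H).Adj (Sum.inl r) (Sum.inr c) ↔ H r c = 1 := by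
  simp [tannerGraph, SimpleGraph.fromRel_adj]

lemma toBase_eq_inl {v : CheckNode γ m Z Lc ⊕ VarNode κ Z Lc} {i : Fin γ} :
    toBase v = Sum.inl i ↔ ∃ a, v = Sum.inl a ∧ a.1.2 = i := by
  cases v <;> simp [toBase]

lemma toBase_eq_inr {v : CheckNode γ m Z Lc ⊕ VarNode κ Z Lc} {j : Fin κ} :
    toBase v = Sum.inr j ↔ ∃ b, v = Sum.inr b ∧ b.1.2 = j := by
  cases v <;> simp [toBase]

lemma FourCycle.Active.exists_parityCheck_eq_one [NeZero Z] {P : PartitionMatrix γ κ m}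
    {L : LiftingMatrix γ κ Z} {c : FourCycle γ κ} (h : c.Active Lc P L) :
    ∃ (a₁ a₂ : CheckNode γ m Z Lc) (b₁ b₂ : VarNode κ Z Lc),
      (a₁.1.2 = c.i₁ ∧ a₂.1.2 = c.i₂ ∧ b₁.1.2 = c.j₁ ∧ b₂.1.2 = c.j₂) ∧
      parityCheck Lc P L a₁ b₁ = 1 ∧ parityCheck Lc P L a₁ b₂ = 1 ∧
      parityCheck Lc P L a₂ b₂ = 1 ∧ parityCheck Lc P L a₂ b₁ = 1 := by
  obtain ⟨v, w, -, hw⟩ := h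
  match w, hw with
  | .cons h₁ (.cons h₂ (.cons h₃ (.cons h₄ .nil))), hw =>
    simp only [SimpleGraph.Walk.support_cons, SimpleGraph.Walk.support_nil, List.map_cons,
      List.map_nil, List.cons.injEq] at hw
    obtain ⟨hv, hx₁, hx₂, hx₃, -⟩ := hw
    obtain ⟨b₁, rfl, hb₁⟩ := toBase_eq_inr.1 hv
    obtain ⟨a₁, rfl, ha₁⟩ := toBase_eq_inl.1 hx₁
    obtain ⟨b₂, rfl, hb₂⟩ := toBase_eq_inr.1 hx₂
    obtain ⟨a₂, rfl, ha₂⟩ := toBase_eq_inl.1 hx₃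
    exact ⟨a₁, a₂, b₁, b₂, ⟨ha₁, ha₂, hb₁, hb₂⟩, tannerGraph_adj_inl_inr.1 h₁.symm,
      tannerGraph_adj_inl_inr.1 h₂, tannerGraph_adj_inl_inr.1 h₃.symm, tannerGraph_adj_inl_inr.1 h₄⟩
  | .nil, hw => simp at hw
  | .cons _ .nil, hw => simp at hw
  | .cons _ (.cons _ .nil), hw => simp at hw
  | .cons _ (.cons _ (.cons _ .nil)), hw => simp at hw
  | .cons _ (.cons _ (.cons _ (.cons _ (.cons _ _)))), hw => simp at hw

lemma FourCycle.Active.rectangleCloses [NeZero Z] {P : PartitionMatrix γ κ m}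
    {L : LiftingMatrix γ κ Z} {c : FourCycle γ κ} (h : c.Active Lc P L) :
    RectangleCloses (edgeShift m Z ∘ fun q => (P q.1 q.2, L q.1 q.2)) c.i₁ c.i₂ c.j₁ c.j₂ := by
  obtain ⟨a₁, a₂, b₁, b₂, ⟨ha₁, ha₂, hb₁, hb₂⟩, h₁₁, h₁₂, h₂₂, h₂₁⟩ := h.exists_parityCheck_eq_one
  have e₁₁ := eq_add_edgeShift_of_parityCheck_eq_one h₁₁
  have e₁₂ := eq_add_edgeShift_of_parityCheck_eq_one h₁₂
  have e₂₂ := eq_add_edgeShift_of_parityCheck_eq_one h₂₂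
  have e₂₁ := eq_add_edgeShift_of_parityCheck_eq_one h₂₁
  rw [ha₁, hb₁] at e₁₁
  rw [ha₁, hb₂] at e₁₂
  rw [ha₂, hb₂] at e₂₂
  rw [ha₂, hb₁] at e₂₁
  refine add_left_cancel (a := ((b₁.1.1 : ℕ), b₁.2) + ((b₂.1.1 : ℕ), b₂.2)) ?_
  simp only [Function.comp_apply]
  rw [add_add_add_comm, ← e₁₁, ← e₂₂, add_comm (_, b₁.2), add_add_add_comm, ← e₁₂, ← e₂₁]

lemma ncard_rectangleFree_le_ncard_feasiblePairs (γ κ m Z Lc : ℕ) [NeZero Z] :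
    (rectangleFree (edgeShift m Z) : Set (Fin γ × Fin κ → Fin (m + 1) × ZMod Z)).ncard ≤
      (feasiblePairs γ κ m Z Lc).ncard := by
  refine Set.ncard_le_ncard_of_injOn
    (fun f => (Matrix.of fun i j => (f (i, j)).1, Matrix.of fun i j => (f (i, j)).2))
    (fun f hf c hc => hf _ _ _ _ c.hi c.hj hc.rectangleCloses) fun f _ g _ hfg => ?_
  rw [Prod.mk.injEq] at hfg
  ext ⟨i, j⟩ : 1
  exact Prod.ext (congrFun₂ hfg.1 i j) (congrFun₂ hfg.2 i j)

lemma closingProb_edgeShift (m Z : ℕ) [NeZero Z] :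
    closingProb (edgeShift m Z) = (2 * m ^ 2 + 4 * m + 3) / (3 * (m + 1) ^ 3 * Z) := by
  have hmap : univ.map (edgeShift m Z) = range (m + 1) ×ˢ univ := by
    rw [← univ_product_univ, edgeShift, prodMap_map_product, Fin.map_valEmbedding_univ,
      Nat.Iio_eq_range, map_refl]
  have henergy : 3 * ((range (m + 1)).addEnergy (range (m + 1)) : ℝ) =
      (m + 1) * (2 * (m + 1) ^ 2 + 1) := mod_cast three_mul_addEnergy_range (m + 1)
  have hZ : (Z : ℝ) ≠ 0 := NeZero.ne _
  rw [closingProb, hmap, addEnergy_product, addEnergy_univ_left]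
  simp only [Fintype.card_prod, Fintype.card_fin, ZMod.card, card_univ]
  push_cast
  field_simp
  linear_combination henergy

lemma natCard_arrays (γ κ m Z : ℕ) [NeZero Z] :
    (Nat.card (Fin γ × Fin κ → Fin (m + 1) × ZMod Z) : ℝ) = ((Z : ℝ) * (m + 1)) ^ (γ * κ) := by
  simp [ZMod.card, mul_comm]

lemma thresholdI_eq (hΔ : Delta γ κ ≠ 0) :
    thresholdI γ κ = 1 / Delta γ κ * (1 - 1 / (Delta γ κ : ℝ)) ^ (Delta γ κ - 1) := by
  have hΔ' : (Delta γ κ : ℝ) ≠ 0 := mod_cast hΔ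
  rw [thresholdI, one_sub_div hΔ', div_pow, div_mul_div_comm, one_mul, ← pow_succ',
    Nat.sub_one_add_one hΔ]

theorem le_ncard_feasiblePairs_of_le_thresholdI [NeZero Z] (hΔ : Delta γ κ ≠ 0)
    (h : closingProb (edgeShift m Z) ≤ thresholdI γ κ) :
    ((Z : ℝ) * (m + 1)) ^ (γ * κ) * (1 - 1 / (Delta γ κ : ℝ)) ^ (γ.choose 2 * κ.choose 2) ≤
      (feasiblePairs γ κ m Z Lc).ncard := by
  have hx : 1 / (Delta γ κ : ℝ) ≤ 1 :=
    (div_le_one₀ (by positivity)).2 (mod_cast Nat.one_le_iff_ne_zero.2 hΔ)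
  rw [thresholdI_eq hΔ] at h
  have hfree := pow_choose_mul_card_le_ncard_rectangleFree (R := Fin γ) (C := Fin κ)
    (edgeShift m Z) (by positivity) hx (by simpa only [Fintype.card_fin, Delta] using h)
  rw [natCard_arrays, Fintype.card_fin, Fintype.card_fin, mul_comm] at hfree
  exact hfree.trans (mod_cast ncard_rectangleFree_le_ncard_feasiblePairs γ κ m Z Lc)

theorem le_ncard_feasiblePairs_of_le_thresholdII [NeZero Z] (hγκ : γ + κ < γ * κ)
    (h : closingProb (edgeShift m Z) ≤ thresholdII γ κ) :
    ((Z : ℝ) * (m + 1)) ^ (γ * κ) *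
        (1 - ((γ : ℝ) * κ - γ - κ + 1) / (4 * ((γ : ℝ) * κ - γ - κ))) ^ (γ * κ) ≤
      (feasiblePairs γ κ m Z Lc).ncard := by
  obtain ⟨N, hN⟩ := Nat.exists_eq_add_of_le hγκ.le
  have hNR : (γ : ℝ) * κ - γ - κ = N := by
    have : (γ : ℝ) * κ = γ + κ + N := mod_cast hN
    linarith
  have hcell : (γ - 1) * (κ - 1) ≤ N + 1 := by
    rcases γ with - | a
    · simp at hγκ
    rcases κ with - | b
    · simp at hγκ
    simp only [Nat.add_sub_cancel]
    linarith
  have hN1 : (1 : ℝ) ≤ N := by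
    have : 1 ≤ N := by omega
    exact_mod_cast this
  have hx : (N + 1) * (1 / (4 * N : ℝ)) ≤ 1 := by
    rw [mul_one_div, div_le_one₀ (by positivity)]
    linarith
  have hp : thresholdII γ κ = 1 / (4 * N) * (1 - N * (1 / (4 * N : ℝ))) ^ 3 := by
    rw [thresholdII, hNR]
    field_simp
    norm_num
  have hfree := pow_card_mul_card_le_ncard_rectangleFree (R := Fin γ) (C := Fin κ) (edgeShift m Z)
    (by simpa only [Fintype.card_fin] using hcell) (by positivity) hx (h.trans_eq hp)
  rw [natCard_arrays, Fintype.card_fin, Fintype.card_fin, mul_one_div, mul_comm] at hfree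
  rw [hNR]
  exact hfree.trans (mod_cast ncard_rectangleFree_le_ncard_feasiblePairs γ κ m Z Lc)

lemma two_le_of_add_lt_mul {a b : ℕ} (h : a + b < a * b) : 2 ≤ a := by
  by_contra! ha
  interval_cases a <;> omega

lemma two_le_Delta (hγκ : γ + κ < γ * κ) : 2 ≤ Delta γ κ := by
  obtain ⟨a, rfl⟩ := Nat.exists_eq_add_of_le (two_le_of_add_lt_mul hγκ)
  obtain ⟨b, rfl⟩ := Nat.exists_eq_add_of_le
    (two_le_of_add_lt_mul ((add_comm _ _).trans_lt (hγκ.trans_eq (mul_comm _ _))))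
  have hΔ : Delta (2 + a) (2 + b) = (2 * a + 1) * (2 * b + 1) := by
    rw [Delta]
    congr 1 <;> omega
  rw [hΔ]
  nlinarith

end QCSC

theorem corollary1 (γ κ m Z Lc : ℕ) [NeZero Z] (hγκ : γ + κ < γ * κ)
    (h : (2 * (m : ℝ) ^ 2 + 4 * m + 3) / (3 * ((m : ℝ) + 1) ^ 3 * Z) ≤
      max (QCSC.thresholdI γ κ) (QCSC.thresholdII γ κ)) :
    ((Z : ℝ) * ((m : ℝ) + 1)) ^ (γ * κ) *
        (if QCSC.thresholdI γ κ > QCSC.thresholdII γ κ then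
          (1 - 2 / (QCSC.Delta γ κ : ℝ)) ^ (γ.choose 2 * κ.choose 2)
        else
          (1 - ((γ : ℝ) * κ - γ - κ + 1) / (4 * ((γ : ℝ) * κ - γ - κ))) ^ (γ * κ)) ≤
      ((QCSC.feasiblePairs γ κ m Z Lc).ncard : ℝ) := by
  rw [← QCSC.closingProb_edgeShift] at h
  split_ifs with hI
  · rw [max_eq_left hI.le] at h
    have hΔ : (2 : ℝ) ≤ QCSC.Delta γ κ := mod_cast QCSC.two_le_Delta hγκ
    refine le_trans ?_ (QCSC.le_ncard_feasiblePairs_of_le_thresholdI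
      (pos_of_gt (QCSC.two_le_Delta hγκ)).ne' h)
    gcongr
    · exact sub_nonneg.2 ((div_le_one₀ (by positivity)).2 hΔ)
    · norm_num
  · rw [max_eq_right (not_lt.1 hI)] at h
    exact QCSC.le_ncard_feasiblePairs_of_le_thresholdII hγκ h
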